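/- **Setting.** Let $q\in\mathbb N$, $n\in\mathbb N_0$, let $a<b$ be real, and let $s_0,s_1,\dots,s_m$ be complex $q\times q$ matrices, where $m=2n$ or $m=2n+1$. Put $$\widehat s_k:=-ab\,s_k+(a+b)s_{k+1}-s_{k+2},$$ and define the block matrices $$H_{1,j}:=(s_{l+k})_{l,k=0}^{j},\qquad H_{2,j}:=(\widehat s_{l+k})_{l,k=0}^{j},\qquad K_{1,j}:=(b s_{l+k}-s_{l+k+1})_{l,k=0}^{j},\qquad K_{2,j}:=(-a s_{l+k}+s_{l+k+1})_{l,k=0}^{j}.$$ Assume that $(s_k)_{k=0}^m$ is Hausdorff positive definite on $[a,b]$: if $m=2n$, then $H_{1,n}$ and (for $n\ge1$) $H_{2,n-1}$ are positive definite; if $m=2n+1$, then $K_{1,n}$ and $K_{2,n}$ are positive definite. **Auxiliary matrices.** Let $T_j$ be the $(j+1)q\times(j+1)q$ block matrix with blocks $I_q$ on the first block subdiagonal and zeros elsewhere, and let $R_j(z):=(I-zT_j)^{-1}$. Let $v_j:=(I_q,0,\dots,0)^{T}$ (block column with $j+1$ blocks). Let $$u_{2,j}:=\begin{pmatrix}-(a+b)s_0+s_1\\-\widehat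 s_0\\ \vdots\\-\widehat s_{j-1}\end{pmatrix},\qquad \widetilde u_{1,j}:=\begin{pmatrix}s_0\\ s_1-bs_0\\ \vdots\\ s_j-bs_{j-1}\end{pmatrix},\qquad Y_{2,j}:=\begin{pmatrix}\widehat s_j\\ \vdots\\ \widehat s_{2j-1}\end{pmatrix},\qquad \widetilde Y_{1,j}:=\begin{pmatrix}bs_j-s_{j+1}\\ \vdots\\ bs_{2j-1}-s_{2j}\end{pmatrix}.$$ **Polynomials.** For $j\ge1$ let $$P_{2,j}(z):=(-Y_{2,j}^*H_{2,j-1}^{-1},I_q)R_j(z)v_j,\qquad Q_{2,j}(z):=-(-Y_{2,j}^*H_{2,j-1}^{-1},I_q)R_j(z)(u_{2,j}+zv_js_0),$$ $$\Gamma_{1,j}(z):=(-\widetilde Y_{1,j}^*K_{1,j-1}^{-1},I_q)R_j(z)v_j,\qquad \Theta_{1,j}(z):=(-\widetilde Y_{1,j}^*K_{1,j-1}^{-1},I_q)R_j(z)\widetilde u_{1,j},$$ and let $P_{2,0}:=I_q$, $Q_{2,0}(z):=-(u_{2,0}+zs_0)$, $\Gamma_{1,0}:=I_q$, $\Theta_{1,0}:=s_0$.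 **Parameters.** For $0\le j\le n-1$ let $$\mathbf t_j:=v_j^*R_j(a)^*K_{1,j}^{-1}R_j(a)v_j,\qquad \mathbf w_j:=(u_{2,j}^*+as_0v_j^*)R_j(a)^*H_{2,j}^{-1}R_j(a)(u_{2,j}+av_js_0).$$ The Dyukarev–Stieltjes matrix (DSM) parameters are $\mathbf m_0:=\mathbf t_0$, $\mathbf l_0:=\mathbf w_0$, and $\mathbf m_j:=\mathbf t_j-\mathbf t_{j-1}$, $\mathbf l_j:=\mathbf w_j-\mathbf w_{j-1}$ for $1\le j\le n-1$. **Claim.** The matrices $\mathbf m_j$ and $\mathbf l_j$, $0\le j\le n-1$, are invertible, and $$Q_{2,j}(a)=(-1)^j\,\mathbf m_0^{-1}\mathbf l_0^{-1}\mathbf m_1^{-1}\mathbf l_1^{-1}\cdots\mathbf l_{j-1}^{-1}\mathbf m_j^{-1},\qquad 0\le j\le n-1,$$ $$\Gamma_{1,j}(a)=(-1)^j\,\mathbf m_0^{-1}\mathbf l_0^{-1}\mathbf m_1^{-1}\mathbf l_1^{-1}\cdots\mathbf m_{j-1}^{-1}\mathbf l_{j-1}^{-1},\qquad 1\le j\le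 n,$$ $$P_{2,j}(a)=(-1)^j\,\mathbf m_0^{-1}\mathbf l_0^{-1}\cdots\mathbf l_{j-1}^{-1}\mathbf m_j^{-1}\,(\mathbf m_0+\mathbf m_1+\cdots+\mathbf m_j),\qquad 1\le j\le n-1,$$ $$\Theta_{1,j}(a)=(-1)^j\,\mathbf m_0^{-1}\mathbf l_0^{-1}\cdots\mathbf m_{j-1}^{-1}\mathbf l_{j-1}^{-1}\,(s_0+\mathbf l_0+\cdots+\mathbf l_{j-1}),\qquad 1\le j\le n.$$ -/

import Mathlib

open scoped Matrix ComplexOrder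

noncomputable section

namespace HausdorffMoment

/-- Complex `q × q` matrices. -/
abbrev Mat (q : ℕ) := Matrix (Fin q) (Fin q) ℂ

/-- Square block matrices with `k × k` blocks of size `q × q`. -/
abbrev BlockMat (k q : ℕ) := Matrix (Fin k × Fin q) (Fin k × Fin q) ℂ

/-- Block columns consisting of `k` blocks of size `q × q`. -/
abbrev BlockCol (k q : ℕ) := Matrix (Fin k × Fin q) (Fin q) ℂ

/-- Block rows consisting of `k` blocks of size `q × q`. -/
abbrev BlockRow (k q : ℕ) := Matrix (Fin q) (Fin k × Fin q) ℂ

variable {q : ℕ}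

/-- The block Hankel matrix `(f (l + k))` for `0 ≤ l, k ≤ j`. -/
def blockHankel (f : ℕ → Mat q) (j : ℕ) : BlockMat (j + 1) q :=
  Matrix.of fun x y => f (x.1 + y.1) x.2 y.2

/-- The block column with the `k` blocks `f i, f (i + 1), …, f (i + k - 1)`. -/
def blockCol (f : ℕ → Mat q) (i k : ℕ) : BlockCol k q :=
  Matrix.of fun x β => f (i + x.1) x.2 β

/-- The block column with the block `A` on top of the block column `B`. -/
def colCons {k : ℕ} (A : Mat q) (B : BlockCol k q) : BlockCol (k + 1) q :=
  Matrix.of fun x β => (Fin.cons (A x.2 β) (fun i => B (i, x.2) β) : Fin (k + 1) → ℂ) x.1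

/-- The block row `(A, B)` with the block `B` as its last entry. -/
def rowSnoc {k : ℕ} (A : BlockRow k q) (B : Mat q) : BlockRow (k + 1) q :=
  Matrix.of fun α x => (Fin.snoc (fun i => A α (i, x.2)) (B α x.2) : Fin (k + 1) → ℂ) x.1

/-- `T_j`: identity blocks on the first block subdiagonal, zero elsewhere. -/
def T (q j : ℕ) : BlockMat (j + 1) q :=
  Matrix.of fun x y => if (x.1 : ℕ) = y.1 + 1 ∧ x.2 = y.2 then 1 else 0

/-- `R_j(z) = (I - z T_j)⁻¹`; the matrix `I - z T_j` is unipotent, hence invertible. -/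
def R (q j : ℕ) (z : ℂ) : BlockMat (j + 1) q := (1 - z • T q j)⁻¹

/-- `v_j`: the block column `(I_q, 0, …, 0)`. -/
def v (q j : ℕ) : BlockCol (j + 1) q := colCons 1 0

/-- `ŝ_k = -ab s_k + (a+b) s_{k+1} - s_{k+2}`. -/
def sHat (a b : ℝ) (s : ℕ → Mat q) (k : ℕ) : Mat q :=
  -((a * b : ℂ) • s k) + (a + b : ℂ) • s (k + 1) - s (k + 2)

/-- `H_{1,j}`. -/
def H₁ (s : ℕ → Mat q) (j : ℕ) : BlockMat (j + 1) q := blockHankel s j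

/-- `H_{2,j}`. -/
def H₂ (a b : ℝ) (s : ℕ → Mat q) (j : ℕ) : BlockMat (j + 1) q :=
  -((a * b : ℂ) • blockHankel s j) + (a + b : ℂ) • blockHankel (fun k => s (k + 1)) j
    - blockHankel (fun k => s (k + 2)) j

/-- `K_{1,j}`. -/
def K₁ (b : ℝ) (s : ℕ → Mat q) (j : ℕ) : BlockMat (j + 1) q :=
  (b : ℂ) • blockHankel s j - blockHankel (fun k => s (k + 1)) j

/-- `K_{2,j}`. -/
def K₂ (a : ℝ) (s : ℕ → Mat q) (j : ℕ) : BlockMat (j + 1) q :=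
  -((a : ℂ) • blockHankel s j) + blockHankel (fun k => s (k + 1)) j

/-- The finite sequence `s_0, …, s_m` is Hausdorff positive definite on `[a,b]`: if `m = 2j`, then
`H_{1,j}` and `H_{2,j-1}` are positive definite (the latter being void for `j = 0`); if
`m = 2j + 1`, then `K_{1,j}` and `K_{2,j}` are positive definite. Only `s_0, …, s_m` enter. -/
def IsHausdorffPosDef (a b : ℝ) (s : ℕ → Mat q) (m : ℕ) : Prop :=
  (∀ j, m = 2 * j → (H₁ s j).PosDef) ∧
  (∀ j, m = 2 * (j + 1) → (H₂ a b s j).PosDef) ∧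
  (∀ j, m = 2 * j + 1 → (K₁ b s j).PosDef ∧ (K₂ a s j).PosDef)

/-- `Ỹ_{1,j} = b y_{[j,2j-1]} - y_{[j+1,2j]}`. -/
def Y₁tilde (b : ℝ) (s : ℕ → Mat q) (j : ℕ) : BlockCol j q :=
  (b : ℂ) • blockCol s j j - blockCol s (j + 1) j

/-- `Y_{2,j} = ŷ_{[j,2j-1]}`. -/
def Y₂ (a b : ℝ) (s : ℕ → Mat q) (j : ℕ) : BlockCol j q := blockCol (sHat a b s) j j

/-- `ũ_{1,j} = y_{[0,j]} - b (0, y_{[0,j-1]})`, so that `ũ_{1,0} = s_0`. -/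
def u₁tilde (b : ℝ) (s : ℕ → Mat q) (j : ℕ) : BlockCol (j + 1) q :=
  blockCol s 0 (j + 1) - (b : ℂ) • colCons 0 (blockCol s 0 j)

/-- `u_{2,j} = (-(a+b) s_0 + s_1, -ŝ_0, …, -ŝ_{j-1})`. -/
def u₂ (a b : ℝ) (s : ℕ → Mat q) (j : ℕ) : BlockCol (j + 1) q :=
  colCons (-((a + b : ℂ) • s 0) + s 1) (-blockCol (sHat a b s) 0 j)

/-- The block row `(-Y_{2,j}^* H_{2,j-1}⁻¹, I_q)` for `j ≥ 1`, and `I_q` for `j = 0`. -/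
def rowH₂ (a b : ℝ) (s : ℕ → Mat q) : (j : ℕ) → BlockRow (j + 1) q
  | 0 => rowSnoc 0 1
  | j + 1 => rowSnoc (-((Y₂ a b s (j + 1))ᴴ * (H₂ a b s j)⁻¹)) 1

/-- The block row `(-Ỹ_{1,j}^* K_{1,j-1}⁻¹, I_q)` for `j ≥ 1`, and `I_q` for `j = 0`. -/
def rowK₁ (b : ℝ) (s : ℕ → Mat q) : (j : ℕ) → BlockRow (j + 1) q
  | 0 => rowSnoc 0 1
  | j + 1 => rowSnoc (-((Y₁tilde b s (j + 1))ᴴ * (K₁ b s j)⁻¹)) 1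

/-- The polynomials `P_{2,j}`, with `P_{2,0} = I_q`. -/
def P₂ (a b : ℝ) (s : ℕ → Mat q) (j : ℕ) (z : ℂ) : Mat q :=
  rowH₂ a b s j * R q j z * v q j

/-- The second kind polynomials `Q_{2,j}`, with `Q_{2,0}(z) = (a + b) s_0 - s_1 - z s_0`. -/
def Q₂ (a b : ℝ) (s : ℕ → Mat q) (j : ℕ) (z : ℂ) : Mat q :=
  -(rowH₂ a b s j * R q j z * (u₂ a b s j + z • (v q j * s 0)))

/-- The polynomials `Γ_{1,j}`, with `Γ_{1,0} = I_q`. -/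
def Γ₁ (b : ℝ) (s : ℕ → Mat q) (j : ℕ) (z : ℂ) : Mat q :=
  rowK₁ b s j * R q j z * v q j

/-- The second kind polynomials `Θ_{1,j}`, with `Θ_{1,0} = s_0`. -/
def Θ₁ (b : ℝ) (s : ℕ → Mat q) (j : ℕ) (z : ℂ) : Mat q :=
  rowK₁ b s j * R q j z * u₁tilde b s j

/-- `v_j^* R_j^*(a) K_{1,j}⁻¹ R_j(a) v_j`. -/
def t (a b : ℝ) (s : ℕ → Mat q) (j : ℕ) : Mat q :=
  (v q j)ᴴ * (R q j a)ᴴ * (K₁ b s j)⁻¹ * R q j a * v q j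

/-- `(u_{2,j}^* + a s_0 v_j^*) R_j^*(a) H_{2,j}⁻¹ R_j(a) (u_{2,j} + a v_j s_0)`. -/
def w (a b : ℝ) (s : ℕ → Mat q) (j : ℕ) : Mat q :=
  ((u₂ a b s j)ᴴ + (a : ℂ) • (s 0 * (v q j)ᴴ)) * (R q j a)ᴴ * (H₂ a b s j)⁻¹ * R q j a *
    (u₂ a b s j + (a : ℂ) • (v q j * s 0))

/-- The Dyukarev–Stieltjes parameters `m_j`. -/
def mParam (a b : ℝ) (s : ℕ → Mat q) : ℕ → Mat q
  | 0 => t a b s 0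
  | j + 1 => t a b s (j + 1) - t a b s j

/-- The Dyukarev–Stieltjes parameters `l_j`, `j ≥ 0`. -/
def lParam (a b : ℝ) (s : ℕ → Mat q) : ℕ → Mat q
  | 0 => w a b s 0
  | j + 1 => w a b s (j + 1) - w a b s j

/-- The ordered product `m_0⁻¹ l_0⁻¹ m_1⁻¹ l_1⁻¹ ⋯ m_{j-1}⁻¹ l_{j-1}⁻¹` (the identity for
`j = 0`). -/
def invProd (a b : ℝ) (s : ℕ → Mat q) : ℕ → Mat q
  | 0 => 1
  | j + 1 => invProd a b s j * (mParam a b s j)⁻¹ * (lParam a b s j)⁻¹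

end HausdorffMoment

end

open scoped Matrix ComplexOrder

noncomputable section

namespace HausdorffMoment

variable {q : ℕ}

/-! Write f for `upperMoment b s` and g for `sHat a b s`. Formally these are the moments of (b - x)σ
and (b - x)(x - a)σ, so g_k = f_{k+1} - a f_k, and their Hankel matrices are `K₁` and `H₂`. The rows
`rowK₁` and `rowH₂` hold the coefficients of the monic orthogonal polynomials of f and g. At the
point a, `Γ₁` is the value of the f-orthogonal polynomial, and `Q₂` is the f-integral of the
g-orthogonal one.

Expanding monomials about a and using orthogonality couples the two families: Q_j Γ_j^* = S_j and
Γ_{j+1} Q_j^* = -Ŝ_j, where S_j and Ŝ_j are the Schur complements of the bordered Hankel matrices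
(`Q₂_mul_Γ₁`, `Γ₁_succ_mul_Q₂`). Inverting a bordered Hankel matrix gives m_j = Γ_j^* S_j⁻¹ Γ_j and
l_j = Q_j^* Ŝ_j⁻¹ Q_j (`mParam_eq`, `lParam_eq`). Hence all these matrices are invertible, Q_j m_j =
Γ_j and Γ_{j+1} l_j = -Q_j, and induction from Γ_0 = I yields the products.

The same expansions, solved through the inverse Hankel matrices, give P_j = Q_j t_j and Θ_{j+1} =
Γ_{j+1}(s_0 + w_j); the sums of parameters telescope to t_j and w_j. -/

/-! ### Block embeddings. -/

/-- The rectangular block Hankel matrix `(f (l + k))` with `m` block rows and `k` block columns. -/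
def rectHankel (f : ℕ → Mat q) (m k : ℕ) : Matrix (Fin m × Fin q) (Fin k × Fin q) ℂ :=
  Matrix.of fun x y => f (x.1 + y.1) x.2 y.2

/-- The embedding of `k` blocks as the first `k` of `k + 1` blocks. -/
def initEmb (q k : ℕ) : Matrix (Fin (k + 1) × Fin q) (Fin k × Fin q) ℂ :=
  (1 : BlockMat (k + 1) q).submatrix id fun y => (y.1.castSucc, y.2)

/-- The embedding of `k` blocks as the last `k` of `k + 1` blocks. -/
def tailEmb (q k : ℕ) : Matrix (Fin (k + 1) × Fin q) (Fin k × Fin q) ℂ :=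
  (1 : BlockMat (k + 1) q).submatrix id fun y => (y.1.succ, y.2)

/-- The block column `(0, …, 0, I)` with `k + 1` blocks. -/
def lastCol (q k : ℕ) : BlockCol (k + 1) q :=
  (1 : BlockMat (k + 1) q).submatrix id fun α => (Fin.last k, α)

lemma tailEmb_apply {k : ℕ} (i : Fin (k + 1)) (l : Fin k) (α β : Fin q) :
    tailEmb q k (i, α) (l, β) = if i = l.succ ∧ α = β then 1 else 0 := by
  simp [tailEmb, Matrix.one_apply]

lemma mul_initEmb {ι : Type*} {k : ℕ} (X : Matrix ι (Fin (k + 1) × Fin q) ℂ) :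
    X * initEmb q k = X.submatrix id fun y => (y.1.castSucc, y.2) := by
  simpa [initEmb] using Matrix.mul_submatrix_one (Equiv.refl _)
    (fun y : Fin k × Fin q => (y.1.castSucc, y.2)) X

lemma mul_tailEmb {ι : Type*} {k : ℕ} (X : Matrix ι (Fin (k + 1) × Fin q) ℂ) :
    X * tailEmb q k = X.submatrix id fun y => (y.1.succ, y.2) := by
  simpa [tailEmb] using Matrix.mul_submatrix_one (Equiv.refl _)
    (fun y : Fin k × Fin q => (y.1.succ, y.2)) X

lemma mul_lastCol {ι : Type*} {k : ℕ} (X : Matrix ι (Fin (k + 1) × Fin q) ℂ) :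
    X * lastCol q k = X.submatrix id fun α => (Fin.last k, α) := by
  simpa [lastCol] using Matrix.mul_submatrix_one (Equiv.refl _)
    (fun α : Fin q => (Fin.last k, α)) X

lemma initEmb_conjTranspose_mul {ι : Type*} {k : ℕ} (X : Matrix (Fin (k + 1) × Fin q) ι ℂ) :
    (initEmb q k)ᴴ * X = X.submatrix (fun y => (y.1.castSucc, y.2)) id := by
  rw [← Matrix.conjTranspose_conjTranspose X, ← Matrix.conjTranspose_mul, mul_initEmb]
  rfl

lemma tailEmb_conjTranspose_mul {ι : Type*} {k : ℕ} (X : Matrix (Fin (k + 1) × Fin q) ι ℂ) :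
    (tailEmb q k)ᴴ * X = X.submatrix (fun y => (y.1.succ, y.2)) id := by
  rw [← Matrix.conjTranspose_conjTranspose X, ← Matrix.conjTranspose_mul, mul_tailEmb]
  rfl

lemma lastCol_conjTranspose_mul {ι : Type*} {k : ℕ} (X : Matrix (Fin (k + 1) × Fin q) ι ℂ) :
    (lastCol q k)ᴴ * X = X.submatrix (fun α => (Fin.last k, α)) id := by
  rw [← Matrix.conjTranspose_conjTranspose X, ← Matrix.conjTranspose_mul, mul_lastCol]
  rfl

lemma tailEmb_mul_zero {ι : Type*} {k : ℕ} (X : Matrix (Fin k × Fin q) ι ℂ) (α : Fin q) (y : ι) :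
    (tailEmb q k * X) (0, α) y = 0 := by
  simp [Matrix.mul_apply, tailEmb, Fin.ext_iff]

lemma tailEmb_mul_succ {ι : Type*} {k : ℕ} (X : Matrix (Fin k × Fin q) ι ℂ) (i : Fin k)
    (α : Fin q) (y : ι) : (tailEmb q k * X) (i.succ, α) y = X (i, α) y := by
  rw [Matrix.mul_apply, Finset.sum_eq_single (i, α)]
  · rw [tailEmb_apply]; simp
  · rintro ⟨l, β⟩ - h
    rw [tailEmb_apply, if_neg, zero_mul]
    rintro ⟨h1, rfl⟩
    exact h (by rw [Fin.succ_injective _ h1])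
  · simp

lemma initEmb_conjTranspose_mul_initEmb (k : ℕ) : (initEmb q k)ᴴ * initEmb q k = 1 := by
  rw [initEmb_conjTranspose_mul]
  ext ⟨i, α⟩ ⟨l, β⟩
  simp [initEmb, Matrix.one_apply, Fin.ext_iff, Prod.ext_iff]

lemma initEmb_conjTranspose_mul_lastCol (k : ℕ) : (initEmb q k)ᴴ * lastCol q k = 0 := by
  rw [initEmb_conjTranspose_mul]
  ext ⟨i, α⟩ β
  simp [lastCol, Fin.ext_iff, i.2.ne]

lemma lastCol_conjTranspose_mul_initEmb (k : ℕ) : (lastCol q k)ᴴ * initEmb q k = 0 := by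
  rw [← Matrix.conjTranspose_conjTranspose (initEmb q k), ← Matrix.conjTranspose_mul,
    initEmb_conjTranspose_mul_lastCol, Matrix.conjTranspose_zero]

lemma lastCol_conjTranspose_mul_lastCol (k : ℕ) : (lastCol q k)ᴴ * lastCol q k = 1 := by
  rw [lastCol_conjTranspose_mul]
  ext α β
  simp [lastCol, Matrix.one_apply]

lemma eq_of_mul_initEmb_of_mul_lastCol {ι : Type*} {k : ℕ}
    {X Y : Matrix ι (Fin (k + 1) × Fin q) ℂ} (h₁ : X * initEmb q k = Y * initEmb q k)
    (h₂ : X * lastCol q k = Y * lastCol q k) : X = Y := by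
  rw [mul_initEmb, mul_initEmb] at h₁
  rw [mul_lastCol, mul_lastCol] at h₂
  ext x ⟨l, β⟩
  cases l using Fin.lastCases with
  | last => exact congrFun (congrFun h₂ x) β
  | cast l => exact congrFun (congrFun h₁ x) (l, β)

/-! ### The block shift and its resolvent. -/

lemma T_eq (j : ℕ) : T q j = tailEmb q j * (initEmb q j)ᴴ := by
  ext ⟨i, α⟩ ⟨l, β⟩
  cases i using Fin.cases with
  | zero => rw [tailEmb_mul_zero]; simp [T]
  | succ i =>
    rw [tailEmb_mul_succ]
    simp [T, initEmb, Matrix.one_apply, Fin.ext_iff, Prod.ext_iff, eq_comm]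

lemma T_mul_zero {ι : Type*} {j : ℕ} (X : Matrix (Fin (j + 1) × Fin q) ι ℂ) (α : Fin q) (y : ι) :
    (T q j * X) (0, α) y = 0 := by
  rw [T_eq, Matrix.mul_assoc, tailEmb_mul_zero]

lemma T_mul_succ {ι : Type*} {j : ℕ} (X : Matrix (Fin (j + 1) × Fin q) ι ℂ) (i : Fin j)
    (α : Fin q) (y : ι) : (T q j * X) (i.succ, α) y = X (i.castSucc, α) y := by
  rw [T_eq, Matrix.mul_assoc, tailEmb_mul_succ, initEmb_conjTranspose_mul]
  rfl

/-- The entries of `X` are those of the finite Neumann series of the nilpotent matrix zT. -/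
lemma one_sub_smul_T_mul {j : ℕ} {z : ℂ} {X : BlockMat (j + 1) q}
    (hX : ∀ i α l β, X (i, α) (l, β) = if l ≤ i ∧ α = β then z ^ ((i : ℕ) - l) else 0) :
    (1 - z • T q j) * X = 1 := by
  ext ⟨i, α⟩ ⟨l, β⟩
  rw [Matrix.sub_mul, Matrix.one_mul, Matrix.smul_mul, Matrix.sub_apply, Matrix.smul_apply]
  cases i using Fin.cases with
  | zero =>
    rw [T_mul_zero, hX]
    by_cases h : l = 0 <;> simp [h, Matrix.one_apply, eq_comm]
  | succ i =>
    rw [T_mul_succ, hX, hX]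
    by_cases hαβ : α = β
    · subst hαβ
      rcases lt_trichotomy (l : ℕ) (i + 1) with h | h | h
      · have h1 : l ≤ i.succ := by simp [Fin.le_def]; omega
        have h2 : l ≤ i.castSucc := by simp [Fin.le_def]; omega
        have h3 : i.succ ≠ l := by simp [Fin.ext_iff]; omega
        have h4 : (i : ℕ) + 1 - l = (i - l) + 1 := by omega
        simp [h1, h2, h3, h4, pow_succ']
      · have h1 : i.succ = l := by simp [Fin.ext_iff, h]
        subst h1
        simp [Fin.le_def]
      · have h1 : ¬ l ≤ i.succ := by simp [Fin.le_def]; omega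
        have h2 : ¬ l ≤ i.castSucc := by simp [Fin.le_def]; omega
        have h3 : i.succ ≠ l := by simp [Fin.ext_iff]; omega
        simp [h1, h2, h3]
    · simp [hαβ]

lemma R_mul (j : ℕ) (z : ℂ) : R q j z * (1 - z • T q j) = 1 :=
  Matrix.nonsing_inv_mul _ <| Matrix.isUnit_det_of_right_inverse <|
    one_sub_smul_T_mul (X := Matrix.of fun x y =>
      if y.1 ≤ x.1 ∧ x.2 = y.2 then z ^ ((x.1 : ℕ) - y.1) else 0) fun _ _ _ _ => rfl

/-- Avoids the entries of the resolvent: identities for `R` are checked after multiplication by I -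
zT, where each block row is a two-term recursion. -/
lemma R_mul_eq {ι : Type*} {j : ℕ} {z : ℂ} {X Y : Matrix (Fin (j + 1) × Fin q) ι ℂ}
    (h : (1 - z • T q j) * X = Y) : R q j z * Y = X := by
  rw [← h, ← Matrix.mul_assoc, R_mul, Matrix.one_mul]

/-! ### Hankel matrices, monic orthogonal polynomials and Schur complements. -/

lemma initEmb_conjTranspose_mul_rectHankel (f : ℕ → Mat q) (k m : ℕ) :
    (initEmb q k)ᴴ * rectHankel f (k + 1) m = rectHankel f k m := by
  rw [initEmb_conjTranspose_mul]
  rfl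

lemma rectHankel_mul_initEmb (f : ℕ → Mat q) (m k : ℕ) :
    rectHankel f m (k + 1) * initEmb q k = rectHankel f m k := by
  rw [mul_initEmb]
  rfl

lemma rectHankel_conjTranspose {f : ℕ → Mat q} {m k : ℕ}
    (hf : ∀ i, i + 1 < m + k → (f i).IsHermitian) :
    (rectHankel f m k)ᴴ = rectHankel f k m := by
  ext ⟨i, α⟩ ⟨l, β⟩
  have := (hf (l + i) (by omega)).apply α β
  simpa [rectHankel, add_comm] using this

/-- The block row of coefficients of the monic polynomial of degree `k` that is orthogonal, with
respect to the moments `f`, to all polynomials of smaller degree. -/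
def orthRow (f : ℕ → Mat q) (k : ℕ) : BlockRow (k + 1) q :=
  (lastCol q k)ᴴ -
    (lastCol q k)ᴴ * rectHankel f (k + 1) k * (rectHankel f k k)⁻¹ * (initEmb q k)ᴴ

/-- The Schur complement of the leading `k × k` block Hankel matrix in the next one. -/
def hankelSchur (f : ℕ → Mat q) (k : ℕ) : Mat q :=
  orthRow f k * rectHankel f (k + 1) (k + 1) * lastCol q k

lemma orthRow_mul_lastCol (f : ℕ → Mat q) (k : ℕ) : orthRow f k * lastCol q k = 1 := by
  rw [orthRow, Matrix.sub_mul, Matrix.mul_assoc _ (initEmb q k)ᴴ, initEmb_conjTranspose_mul_lastCol,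
    Matrix.mul_zero, sub_zero, lastCol_conjTranspose_mul_lastCol]

lemma orthRow_mul_rectHankel {f : ℕ → Mat q} {k : ℕ} (h : IsUnit (rectHankel f k k)) :
    orthRow f k * rectHankel f (k + 1) k = 0 := by
  rw [orthRow, Matrix.sub_mul, Matrix.mul_assoc _ (initEmb q k)ᴴ,
    initEmb_conjTranspose_mul_rectHankel, Matrix.mul_assoc,
    Matrix.nonsing_inv_mul _ ((Matrix.isUnit_iff_isUnit_det _).1 h), Matrix.mul_one, sub_self]

lemma orthRow_mul_rectHankel_succ {f : ℕ → Mat q} {k : ℕ} (h : IsUnit (rectHankel f k k)) :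
    orthRow f k * rectHankel f (k + 1) (k + 1) = hankelSchur f k * (lastCol q k)ᴴ := by
  apply eq_of_mul_initEmb_of_mul_lastCol
  · rw [Matrix.mul_assoc, rectHankel_mul_initEmb, orthRow_mul_rectHankel h, Matrix.mul_assoc,
      lastCol_conjTranspose_mul_initEmb, Matrix.mul_zero]
  · rw [Matrix.mul_assoc (hankelSchur f k), lastCol_conjTranspose_mul_lastCol, Matrix.mul_one,
      hankelSchur]

lemma rectHankel_mul_orthRow_conjTranspose {f : ℕ → Mat q} {k : ℕ}
    (hf : ∀ i ≤ 2 * k, (f i).IsHermitian) (h : IsUnit (rectHankel f k k)) :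
    rectHankel f (k + 1) (k + 1) * (orthRow f k)ᴴ = lastCol q k * (hankelSchur f k)ᴴ := by
  rw [← rectHankel_conjTranspose fun i hi => hf i (by omega), ← Matrix.conjTranspose_mul,
    orthRow_mul_rectHankel_succ h, Matrix.conjTranspose_mul, Matrix.conjTranspose_conjTranspose]

lemma hankelSchur_isHermitian {f : ℕ → Mat q} {k : ℕ}
    (hf : ∀ i ≤ 2 * k, (f i).IsHermitian) (h : IsUnit (rectHankel f k k)) :
    (hankelSchur f k)ᴴ = hankelSchur f k := by
  calc (hankelSchur f k)ᴴ
      = orthRow f k * lastCol q k * (hankelSchur f k)ᴴ := by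
        rw [orthRow_mul_lastCol, Matrix.one_mul]
    _ = orthRow f k * rectHankel f (k + 1) (k + 1) * (orthRow f k)ᴴ := by
        rw [Matrix.mul_assoc, Matrix.mul_assoc, rectHankel_mul_orthRow_conjTranspose hf h]
    _ = hankelSchur f k * (orthRow f k * lastCol q k)ᴴ := by
        rw [orthRow_mul_rectHankel_succ h, Matrix.conjTranspose_mul, Matrix.mul_assoc]
    _ = hankelSchur f k := by
        rw [orthRow_mul_lastCol, Matrix.conjTranspose_one, Matrix.mul_one]

lemma isUnit_hankelSchur {f : ℕ → Mat q} {k : ℕ} (h : IsUnit (rectHankel f k k))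
    (h' : IsUnit (rectHankel f (k + 1) (k + 1))) : IsUnit (hankelSchur f k) := by
  -- The witness is the last diagonal block of the inverse Hankel matrix.
  apply IsUnit.of_mul_eq_one
    ((lastCol q k)ᴴ * (rectHankel f (k + 1) (k + 1))⁻¹ * lastCol q k)
  rw [← Matrix.mul_assoc, ← Matrix.mul_assoc, ← orthRow_mul_rectHankel_succ h,
    Matrix.mul_nonsing_inv_cancel_right _ _ ((Matrix.isUnit_iff_isUnit_det _).1 h'),
    orthRow_mul_lastCol]

/-- Block inversion by Schur complement: bordering adds to the old inverse one term carried by the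
orthogonal row. In quadratic forms this term is the increment m_j or l_j. -/
lemma rectHankel_succ_inv {f : ℕ → Mat q} {k : ℕ} (hf : ∀ i ≤ 2 * k, (f i).IsHermitian)
    (h : IsUnit (rectHankel f k k)) (h' : IsUnit (rectHankel f (k + 1) (k + 1))) :
    (rectHankel f (k + 1) (k + 1))⁻¹ =
      initEmb q k * (rectHankel f k k)⁻¹ * (initEmb q k)ᴴ +
        (orthRow f k)ᴴ * (hankelSchur f k)⁻¹ * orthRow f k := by
  have hS := (Matrix.isUnit_iff_isUnit_det _).1 (isUnit_hankelSchur h h')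
  have hK := (Matrix.isUnit_iff_isUnit_det _).1 h
  apply Matrix.inv_eq_left_inv
  have h1 : (orthRow f k)ᴴ =
      lastCol q k - initEmb q k * (rectHankel f k k)⁻¹ * rectHankel f k (k + 1) * lastCol q k := by
    rw [orthRow, Matrix.conjTranspose_sub, Matrix.conjTranspose_mul, Matrix.conjTranspose_mul,
      Matrix.conjTranspose_mul, Matrix.conjTranspose_conjTranspose,
      Matrix.conjTranspose_conjTranspose, Matrix.conjTranspose_nonsing_inv,
      rectHankel_conjTranspose fun i hi => hf i (by omega),
      rectHankel_conjTranspose fun i hi => hf i (by omega)]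
    simp only [Matrix.mul_assoc]
  rw [Matrix.add_mul, Matrix.mul_assoc _ (orthRow f k), orthRow_mul_rectHankel_succ h,
    Matrix.mul_assoc _ (initEmb q k)ᴴ, initEmb_conjTranspose_mul_rectHankel, ← Matrix.mul_assoc,
    Matrix.nonsing_inv_mul_cancel_right _ _ hS, h1, Matrix.sub_mul]
  apply eq_of_mul_initEmb_of_mul_lastCol
  · rw [Matrix.add_mul, Matrix.mul_assoc, rectHankel_mul_initEmb, Matrix.sub_mul,
      Matrix.mul_assoc (lastCol q k), Matrix.mul_assoc _ (lastCol q k)ᴴ,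
      lastCol_conjTranspose_mul_initEmb, Matrix.nonsing_inv_mul_cancel_right _ _ hK]
    simp
  · rw [Matrix.add_mul, Matrix.sub_mul, Matrix.mul_assoc _ (lastCol q k)ᴴ,
      Matrix.mul_assoc _ (lastCol q k)ᴴ, lastCol_conjTranspose_mul_lastCol]
    simp

lemma conjTranspose_mul_rectHankel_succ_inv_mul {f : ℕ → Mat q} {k : ℕ}
    (hf : ∀ i ≤ 2 * k, (f i).IsHermitian) (h : IsUnit (rectHankel f k k))
    (h' : IsUnit (rectHankel f (k + 1) (k + 1))) (X : BlockCol (k + 1) q) :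
    Xᴴ * (rectHankel f (k + 1) (k + 1))⁻¹ * X =
      ((initEmb q k)ᴴ * X)ᴴ * (rectHankel f k k)⁻¹ * ((initEmb q k)ᴴ * X) +
        (orthRow f k * X)ᴴ * (hankelSchur f k)⁻¹ * (orthRow f k * X) := by
  rw [rectHankel_succ_inv hf h h', Matrix.mul_add, Matrix.add_mul]
  simp only [Matrix.conjTranspose_mul, Matrix.conjTranspose_conjTranspose, Matrix.mul_assoc]

/-! ### Evaluation and divided differences. -/

/-- The block column `(1, z, …, z ^ j)`. -/
def powCol (q j : ℕ) (z : ℂ) : BlockCol (j + 1) q := R q j z * v q j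

/-- The matrix that sends the coefficients of a polynomial `p` to those of the divided difference
`(p(x) - p(z)) / (x - z)`. -/
def divDiff (q j : ℕ) (z : ℂ) : Matrix (Fin (j + 1) × Fin q) (Fin j × Fin q) ℂ :=
  R q j z * tailEmb q j

/-- This is x^i = z^i + (x - z)·(x^i - z^i)/(x - z) integrated against x^l, the factor x - z turning
f into g. Hermitian moments are needed because the f-integrals enter through a conjugate transpose.
-/
lemma rectHankel_eq {f g : ℕ → Mat q} {z : ℂ} (hfg : ∀ k, g k = f (k + 1) - z • f k) {k m : ℕ}
    (hf : ∀ i < m, (f i).IsHermitian) :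
    rectHankel f (k + 1) m =
      powCol q k z * (blockCol f 0 m)ᴴ + divDiff q k z * rectHankel g k m := by
  rw [powCol, divDiff, Matrix.mul_assoc, Matrix.mul_assoc, ← Matrix.mul_add]
  symm
  apply R_mul_eq
  ext ⟨i, α⟩ ⟨l, β⟩
  rw [Matrix.sub_mul, Matrix.one_mul, Matrix.smul_mul, Matrix.sub_apply, Matrix.smul_apply,
    Matrix.add_apply]
  cases i using Fin.cases with
  | zero =>
    rw [T_mul_zero, tailEmb_mul_zero]
    have := (hf l l.2).apply α β
    simpa [rectHankel, v, colCons, Matrix.mul_apply, blockCol, Matrix.one_apply] using this.symm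
  | succ i =>
    rw [T_mul_succ, tailEmb_mul_succ]
    simp [rectHankel, v, colCons, Matrix.mul_apply, hfg, add_right_comm]

lemma initEmb_conjTranspose_mul_powCol (j : ℕ) (z : ℂ) :
    (initEmb q (j + 1))ᴴ * powCol q (j + 1) z = powCol q j z := by
  symm
  apply R_mul_eq
  have h : (1 - z • T q (j + 1)) * powCol q (j + 1) z = v q (j + 1) := by
    rw [powCol, ← Matrix.mul_assoc, mul_eq_one_comm.1 (R_mul (j + 1) z), Matrix.one_mul]
  ext ⟨i, α⟩ β
  have hi := congrFun (congrFun h (i.castSucc, α)) β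
  rw [Matrix.sub_mul, Matrix.one_mul, Matrix.smul_mul, Matrix.sub_apply, Matrix.smul_apply] at hi ⊢
  rw [initEmb_conjTranspose_mul]
  cases i using Fin.cases with
  | zero =>
    rw [T_mul_zero]
    rw [Fin.castSucc_zero, T_mul_zero] at hi
    exact hi
  | succ i =>
    rw [T_mul_succ]
    rw [Fin.castSucc_succ, T_mul_succ] at hi
    simpa [v, colCons] using hi

/-- Dividing p(x) - p(z) by x - z keeps the leading coefficient. -/
lemma divDiff_mul_lastCol (j : ℕ) (z : ℂ) :
    divDiff q (j + 1) z * lastCol q j = lastCol q (j + 1) := by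
  rw [divDiff, Matrix.mul_assoc]
  apply R_mul_eq
  rw [T_eq, Matrix.sub_mul, Matrix.one_mul, Matrix.smul_mul, Matrix.mul_assoc,
    initEmb_conjTranspose_mul_lastCol, Matrix.mul_zero, smul_zero, sub_zero]
  ext ⟨i, α⟩ β
  cases i using Fin.cases with
  | zero => rw [tailEmb_mul_zero]; simp [lastCol, Fin.ext_iff]
  | succ i =>
    rw [tailEmb_mul_succ]
    simp [lastCol, Matrix.one_apply, ← Fin.succ_last]

/-! ### Coupling of the orthogonal polynomials of f and g. -/

section Coupling

variable {f g : ℕ → Mat q} {z : ℂ} {j : ℕ}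

/-- Expand the test monomial about z: the part with the factor x - z is a g-integral against degree
below j, so orthogonality kills it. -/
lemma orthRow_mul_rectHankel_shift (hfg : ∀ k, g k = f (k + 1) - z • f k)
    (hf : ∀ i ≤ 2 * j, (f i).IsHermitian) (hg : ∀ i < 2 * j, (g i).IsHermitian)
    (hgu : IsUnit (rectHankel g j j)) :
    orthRow g j * rectHankel f (j + 1) (j + 1) =
      orthRow g j * blockCol f 0 (j + 1) * (powCol q j z)ᴴ := by
  rw [← rectHankel_conjTranspose fun i hi => hf i (by omega),
    rectHankel_eq hfg fun i hi => hf i (by omega), Matrix.conjTranspose_add,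
    Matrix.conjTranspose_mul, Matrix.conjTranspose_mul, Matrix.conjTranspose_conjTranspose,
    rectHankel_conjTranspose fun i hi => hg i (by omega), Matrix.mul_add, ← Matrix.mul_assoc,
    ← Matrix.mul_assoc, orthRow_mul_rectHankel hgu, Matrix.zero_mul, add_zero]

/-- Pairing the previous identity with the f-orthogonal polynomial leaves only the leading
coefficient of the g-orthogonal one, which is I. -/
lemma orthRow_mul_blockCol_mul_conjTranspose (hfg : ∀ k, g k = f (k + 1) - z • f k)
    (hf : ∀ i ≤ 2 * j, (f i).IsHermitian) (hg : ∀ i < 2 * j, (g i).IsHermitian)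
    (hfu : IsUnit (rectHankel f j j)) (hgu : IsUnit (rectHankel g j j)) :
    orthRow g j * blockCol f 0 (j + 1) * (orthRow f j * powCol q j z)ᴴ = hankelSchur f j := by
  rw [Matrix.conjTranspose_mul, ← Matrix.mul_assoc, ← orthRow_mul_rectHankel_shift hfg hf hg hgu,
    Matrix.mul_assoc, rectHankel_mul_orthRow_conjTranspose hf hfu, ← Matrix.mul_assoc,
    orthRow_mul_lastCol, Matrix.one_mul, hankelSchur_isHermitian hf hfu]

lemma orthRow_mul_powCol (hfg : ∀ k, g k = f (k + 1) - z • f k)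
    (hf : ∀ i ≤ 2 * j, (f i).IsHermitian) (hg : ∀ i < 2 * j, (g i).IsHermitian)
    (hfu : IsUnit (rectHankel f (j + 1) (j + 1))) (hgu : IsUnit (rectHankel g j j)) :
    orthRow g j * powCol q j z = orthRow g j * blockCol f 0 (j + 1) *
      ((powCol q j z)ᴴ * (rectHankel f (j + 1) (j + 1))⁻¹ * powCol q j z) := by
  rw [← Matrix.mul_assoc, ← Matrix.mul_assoc, ← orthRow_mul_rectHankel_shift hfg hf hg hgu,
    Matrix.mul_nonsing_inv_cancel_right _ _ ((Matrix.isUnit_iff_isUnit_det _).1 hfu)]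

/-- Here the f-orthogonal polynomial itself is expanded about z. Its integrals against degrees at
most j vanish, so the two parts cancel; this is the origin of the alternating signs. -/
lemma orthRow_mul_divDiff_mul_rectHankel (hfg : ∀ k, g k = f (k + 1) - z • f k)
    (hf : ∀ i ≤ j, (f i).IsHermitian) (hfu : IsUnit (rectHankel f (j + 1) (j + 1))) :
    orthRow f (j + 1) * divDiff q (j + 1) z * rectHankel g (j + 1) (j + 1) =
      -(orthRow f (j + 1) * powCol q (j + 1) z * (blockCol f 0 (j + 1))ᴴ) := by
  have h := orthRow_mul_rectHankel hfu
  rw [rectHankel_eq hfg fun i hi => hf i (by omega), Matrix.mul_add, ← Matrix.mul_assoc,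
    ← Matrix.mul_assoc] at h
  exact eq_neg_of_add_eq_zero_right h

/-- The divided difference is monic of degree j, so pairing it with the g-orthogonal polynomial
leaves the Schur complement of g. -/
lemma orthRow_succ_mul_powCol_mul_conjTranspose (hfg : ∀ k, g k = f (k + 1) - z • f k)
    (hf : ∀ i ≤ j, (f i).IsHermitian) (hg : ∀ i ≤ 2 * j, (g i).IsHermitian)
    (hfu : IsUnit (rectHankel f (j + 1) (j + 1))) (hgu : IsUnit (rectHankel g j j)) :
    orthRow f (j + 1) * powCol q (j + 1) z * (orthRow g j * blockCol f 0 (j + 1))ᴴ =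
      -hankelSchur g j := by
  rw [Matrix.conjTranspose_mul, ← Matrix.mul_assoc, ← neg_eq_iff_eq_neg, ← Matrix.neg_mul,
    ← orthRow_mul_divDiff_mul_rectHankel hfg hf hfu, Matrix.mul_assoc,
    rectHankel_mul_orthRow_conjTranspose hg hgu, ← Matrix.mul_assoc,
    Matrix.mul_assoc _ _ (lastCol q j), divDiff_mul_lastCol, orthRow_mul_lastCol, Matrix.one_mul,
    hankelSchur_isHermitian hg hgu]

lemma orthRow_mul_divDiff_mul_blockCol (hfg : ∀ k, g k = f (k + 1) - z • f k)
    (hf : ∀ i ≤ j, (f i).IsHermitian) (hfu : IsUnit (rectHankel f (j + 1) (j + 1)))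
    (hgu : IsUnit (rectHankel g (j + 1) (j + 1))) :
    orthRow f (j + 1) * divDiff q (j + 1) z * blockCol f 0 (j + 1) =
      -(orthRow f (j + 1) * powCol q (j + 1) z * ((blockCol f 0 (j + 1))ᴴ *
        (rectHankel g (j + 1) (j + 1))⁻¹ * blockCol f 0 (j + 1))) := by
  rw [← Matrix.mul_assoc, ← Matrix.mul_assoc, ← Matrix.neg_mul, ← Matrix.neg_mul,
    ← orthRow_mul_divDiff_mul_rectHankel hfg hf hfu,
    Matrix.mul_nonsing_inv_cancel_right _ _ ((Matrix.isUnit_iff_isUnit_det _).1 hgu)]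

end Coupling

/-! ### Translation into the moment sequences f and g. -/

/-- The moments `b s_k - s_{k+1}` of the measure with density `b - x`. -/
def upperMoment (b : ℝ) (s : ℕ → Mat q) (k : ℕ) : Mat q := (b : ℂ) • s k - s (k + 1)

lemma sHat_eq (a b : ℝ) (s : ℕ → Mat q) (k : ℕ) :
    sHat a b s k = upperMoment b s (k + 1) - (a : ℂ) • upperMoment b s k := by
  simp only [sHat, upperMoment]
  module

lemma K₁_eq (b : ℝ) (s : ℕ → Mat q) (j : ℕ) :
    K₁ b s j = rectHankel (upperMoment b s) (j + 1) (j + 1) := by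
  ext x y
  simp [K₁, blockHankel, rectHankel, upperMoment]

lemma H₂_eq (a b : ℝ) (s : ℕ → Mat q) (j : ℕ) :
    H₂ a b s j = rectHankel (sHat a b s) (j + 1) (j + 1) := by
  ext x y
  simp [H₂, blockHankel, rectHankel, sHat]

lemma upperMoment_isHermitian {b : ℝ} {s : ℕ → Mat q} {k : ℕ} (h : (s k).IsHermitian)
    (h' : (s (k + 1)).IsHermitian) : (upperMoment b s k).IsHermitian :=
  (h.smul (by simp [isSelfAdjoint_iff])).sub h'

lemma sHat_isHermitian {a b : ℝ} {s : ℕ → Mat q} {k : ℕ} (h : (s k).IsHermitian)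
    (h' : (s (k + 1)).IsHermitian) (h'' : (s (k + 2)).IsHermitian) :
    (sHat a b s k).IsHermitian := by
  rw [sHat_eq]
  exact (upperMoment_isHermitian h' h'').sub
    ((upperMoment_isHermitian h h').smul (by simp [isSelfAdjoint_iff]))

lemma rowSnoc_eq {k : ℕ} (A : BlockRow k q) :
    rowSnoc A 1 = (lastCol q k)ᴴ + A * (initEmb q k)ᴴ := by
  apply eq_of_mul_initEmb_of_mul_lastCol
  · rw [Matrix.add_mul, lastCol_conjTranspose_mul_initEmb, Matrix.mul_assoc,
      initEmb_conjTranspose_mul_initEmb, zero_add, Matrix.mul_one, mul_initEmb]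
    ext α y
    simp [rowSnoc]
  · rw [Matrix.add_mul, lastCol_conjTranspose_mul_lastCol, Matrix.mul_assoc,
      initEmb_conjTranspose_mul_lastCol, Matrix.mul_zero, add_zero, mul_lastCol]
    ext α y
    simp [rowSnoc]

lemma orthRow_zero (f : ℕ → Mat q) : orthRow f 0 = rowSnoc 0 1 := by
  rw [rowSnoc_eq, orthRow, sub_eq_add_neg, ← Matrix.neg_mul]
  congr 2
  ext _ y
  exact y.1.elim0

lemma orthRow_eq_rowSnoc {f : ℕ → Mat q} {k : ℕ} (hf : ∀ i < 2 * k, (f i).IsHermitian) :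
    orthRow f k = rowSnoc (-((blockCol f k k)ᴴ * (rectHankel f k k)⁻¹)) 1 := by
  rw [rowSnoc_eq, orthRow, sub_eq_add_neg, ← Matrix.neg_mul]
  congr 4
  rw [lastCol_conjTranspose_mul]
  ext α ⟨l, β⟩
  have := (hf (k + l) (by omega)).apply α β
  simpa [blockCol, rectHankel] using this.symm

lemma rowH₂_eq {a b : ℝ} {s : ℕ → Mat q} {j : ℕ}
    (h : ∀ i < 2 * j, (sHat a b s i).IsHermitian) : rowH₂ a b s j = orthRow (sHat a b s) j := by
  cases j with
  | zero => rw [orthRow_zero, rowH₂]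
  | succ j => rw [orthRow_eq_rowSnoc h, rowH₂, H₂_eq, Y₂]

lemma rowK₁_eq {b : ℝ} {s : ℕ → Mat q} {j : ℕ}
    (h : ∀ i < 2 * j, (upperMoment b s i).IsHermitian) :
    rowK₁ b s j = orthRow (upperMoment b s) j := by
  cases j with
  | zero => rw [orthRow_zero, rowK₁]
  | succ j =>
    have hY : Y₁tilde b s (j + 1) = blockCol (upperMoment b s) (j + 1) (j + 1) := by
      ext x β
      simp [Y₁tilde, blockCol, upperMoment, add_right_comm]
    rw [orthRow_eq_rowSnoc h, rowK₁, K₁_eq, hY]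

/-- Below the first block row this is f_{i+1} - a f_i = ŝ_i. It makes `Q₂` at a an f-integral. -/
lemma R_mul_u₂_add (a b : ℝ) (s : ℕ → Mat q) (j : ℕ) :
    R q j a * (u₂ a b s j + (a : ℂ) • (v q j * s 0)) =
      -blockCol (upperMoment b s) 0 (j + 1) := by
  apply R_mul_eq
  ext ⟨i, α⟩ β
  rw [Matrix.sub_mul, Matrix.one_mul, Matrix.smul_mul, Matrix.sub_apply, Matrix.smul_apply]
  cases i using Fin.cases with
  | zero =>
    rw [T_mul_zero]
    simp [u₂, v, colCons, Matrix.mul_apply, blockCol, upperMoment, Matrix.one_apply]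
    ring
  | succ i =>
    rw [T_mul_succ]
    simp [u₂, v, colCons, Matrix.mul_apply, blockCol, sHat_eq]
    ring

lemma R_mul_u₁tilde (a b : ℝ) (s : ℕ → Mat q) (j : ℕ) :
    R q (j + 1) a * u₁tilde b s (j + 1) = powCol q (j + 1) a * s 0 -
      divDiff q (j + 1) a * blockCol (upperMoment b s) 0 (j + 1) := by
  have h : u₁tilde b s (j + 1) =
      v q (j + 1) * s 0 - tailEmb q (j + 1) * blockCol (upperMoment b s) 0 (j + 1) := by
    ext ⟨i, α⟩ β
    rw [Matrix.sub_apply]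
    cases i using Fin.cases with
    | zero =>
      rw [tailEmb_mul_zero]
      simp [u₁tilde, v, colCons, Matrix.mul_apply, blockCol, Matrix.one_apply]
    | succ i =>
      rw [tailEmb_mul_succ]
      simp [u₁tilde, v, colCons, Matrix.mul_apply, blockCol, upperMoment]
  rw [h, Matrix.mul_sub, ← Matrix.mul_assoc, ← Matrix.mul_assoc, powCol, divDiff]

lemma t_eq (a b : ℝ) (s : ℕ → Mat q) (j : ℕ) :
    t a b s j = (powCol q j a)ᴴ * (rectHankel (upperMoment b s) (j + 1) (j + 1))⁻¹ *
      powCol q j a := by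
  simp only [t, powCol, K₁_eq, Matrix.conjTranspose_mul, Matrix.mul_assoc]

lemma w_eq {a b : ℝ} {s : ℕ → Mat q} {j : ℕ} (h : (s 0).IsHermitian) :
    w a b s j = (blockCol (upperMoment b s) 0 (j + 1))ᴴ *
      (rectHankel (sHat a b s) (j + 1) (j + 1))⁻¹ * blockCol (upperMoment b s) 0 (j + 1) := by
  have h1 : (u₂ a b s j)ᴴ + (a : ℂ) • (s 0 * (v q j)ᴴ) =
      (u₂ a b s j + (a : ℂ) • (v q j * s 0))ᴴ := by
    rw [Matrix.conjTranspose_add, Matrix.conjTranspose_smul, Matrix.conjTranspose_mul, h.eq]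
    simp
  rw [w, h1, ← Matrix.conjTranspose_mul, Matrix.mul_assoc, R_mul_u₂_add, H₂_eq]
  simp

lemma sum_mParam (a b : ℝ) (s : ℕ → Mat q) (j : ℕ) :
    ∑ k ∈ Finset.range (j + 1), mParam a b s k = t a b s j := by
  induction j with
  | zero => simp [mParam]
  | succ j ih => rw [Finset.sum_range_succ, ih, mParam, add_sub_cancel]

lemma sum_lParam (a b : ℝ) (s : ℕ → Mat q) (j : ℕ) :
    ∑ k ∈ Finset.range (j + 1), lParam a b s k = w a b s j := by
  induction j with
  | zero => simp [lParam]
  | succ j ih => rw [Finset.sum_range_succ, ih, lParam, add_sub_cancel]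

/-! ### Values at a and the Dyukarev–Stieltjes parameters. -/

/-- The consequences of Hausdorff positive definiteness that the multiplicative structure of the
orthogonal matrix polynomials rests on. -/
structure IsRegular (a b : ℝ) (s : ℕ → Mat q) (n : ℕ) : Prop where
  isHermitian : ∀ k ≤ 2 * n, (s k).IsHermitian
  isUnit_K₁ : ∀ j < n, IsUnit (K₁ b s j)
  isUnit_H₂ : ∀ j < n, IsUnit (H₂ a b s j)

namespace IsRegular

variable {a b : ℝ} {s : ℕ → Mat q} {n j : ℕ}

lemma isHermitian_upperMoment (h : IsRegular a b s n) {i : ℕ} (hi : i < 2 * n) :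
    (upperMoment b s i).IsHermitian :=
  upperMoment_isHermitian (h.isHermitian _ (by omega)) (h.isHermitian _ (by omega))

lemma isHermitian_sHat (h : IsRegular a b s n) {i : ℕ} (hi : i + 1 < 2 * n) :
    (sHat a b s i).IsHermitian :=
  sHat_isHermitian (h.isHermitian _ (by omega)) (h.isHermitian _ (by omega))
    (h.isHermitian _ (by omega))

lemma isUnit_upperMoment (h : IsRegular a b s n) (hj : j ≤ n) :
    IsUnit (rectHankel (upperMoment b s) j j) := by
  cases j with
  | zero => exact isUnit_of_subsingleton _
  | succ j => exact K₁_eq b s j ▸ h.isUnit_K₁ j hj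

lemma isUnit_sHat (h : IsRegular a b s n) (hj : j ≤ n) :
    IsUnit (rectHankel (sHat a b s) j j) := by
  cases j with
  | zero => exact isUnit_of_subsingleton _
  | succ j => exact H₂_eq a b s j ▸ h.isUnit_H₂ j hj

lemma Γ₁_eq (h : IsRegular a b s n) (hj : j ≤ n) :
    Γ₁ b s j a = orthRow (upperMoment b s) j * powCol q j a := by
  rw [Γ₁, rowK₁_eq fun i hi => h.isHermitian_upperMoment (by omega), Matrix.mul_assoc, powCol]

/-- The inequality is strict, unlike for `Γ₁`: for j ≥ 1 the row of degree j involves moments up to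
s_{2j+1}, whereas `rowK₁` stops at s_{2j}. -/
lemma P₂_eq (h : IsRegular a b s n) (hj : j < n) :
    P₂ a b s j a = orthRow (sHat a b s) j * powCol q j a := by
  rw [P₂, rowH₂_eq fun i hi => h.isHermitian_sHat (by omega), Matrix.mul_assoc, powCol]

lemma Q₂_eq (h : IsRegular a b s n) (hj : j < n) :
    Q₂ a b s j a = orthRow (sHat a b s) j *
      blockCol (upperMoment b s) 0 (j + 1) := by
  rw [Q₂, rowH₂_eq fun i hi => h.isHermitian_sHat (by omega), Matrix.mul_assoc, R_mul_u₂_add,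
    Matrix.mul_neg, neg_neg]

lemma Q₂_mul_Γ₁ (h : IsRegular a b s n) (hj : j < n) :
    Q₂ a b s j a * (Γ₁ b s j a)ᴴ = hankelSchur (upperMoment b s) j := by
  rw [h.Q₂_eq hj, h.Γ₁_eq hj.le]
  exact orthRow_mul_blockCol_mul_conjTranspose (sHat_eq a b s)
    (fun i hi => h.isHermitian_upperMoment (by omega)) (fun i hi => h.isHermitian_sHat (by omega))
    (h.isUnit_upperMoment hj.le) (h.isUnit_sHat hj.le)

lemma Γ₁_succ_mul_Q₂ (h : IsRegular a b s n) (hj : j < n) :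
    Γ₁ b s (j + 1) a * (Q₂ a b s j a)ᴴ = -hankelSchur (sHat a b s) j := by
  rw [h.Q₂_eq hj, h.Γ₁_eq hj]
  exact orthRow_succ_mul_powCol_mul_conjTranspose (sHat_eq a b s)
    (fun i hi => h.isHermitian_upperMoment (by omega)) (fun i hi => h.isHermitian_sHat (by omega))
    (h.isUnit_upperMoment hj) (h.isUnit_sHat hj.le)

lemma P₂_eq_Q₂_mul (h : IsRegular a b s n) (hj : j < n) :
    P₂ a b s j a = Q₂ a b s j a * t a b s j := by
  rw [h.P₂_eq hj, h.Q₂_eq hj, t_eq]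
  exact orthRow_mul_powCol (sHat_eq a b s)
    (fun i hi => h.isHermitian_upperMoment (by omega)) (fun i hi => h.isHermitian_sHat (by omega))
    (h.isUnit_upperMoment hj) (h.isUnit_sHat hj.le)

lemma Θ₁_succ_eq_Γ₁_mul (h : IsRegular a b s n) (hj : j < n) :
    Θ₁ b s (j + 1) a = Γ₁ b s (j + 1) a * (s 0 + w a b s j) := by
  rw [Θ₁, rowK₁_eq fun i hi => h.isHermitian_upperMoment (by omega), Matrix.mul_assoc,
    R_mul_u₁tilde,
    h.Γ₁_eq hj, w_eq (h.isHermitian 0 (by omega)), Matrix.mul_sub, Matrix.mul_add,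
    ← Matrix.mul_assoc, ← Matrix.mul_assoc _ (divDiff _ _ _),
    orthRow_mul_divDiff_mul_blockCol (sHat_eq a b s)
      (fun i hi => h.isHermitian_upperMoment (by omega))
      (h.isUnit_upperMoment hj) (h.isUnit_sHat hj), sub_neg_eq_add]

lemma mParam_eq (h : IsRegular a b s n) (hj : j < n) :
    mParam a b s j =
      (Γ₁ b s j a)ᴴ * (hankelSchur (upperMoment b s) j)⁻¹ * Γ₁ b s j a := by
  have key := conjTranspose_mul_rectHankel_succ_inv_mul (k := j)
    (fun i hi => h.isHermitian_upperMoment (by omega)) (h.isUnit_upperMoment hj.le)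
    (h.isUnit_upperMoment hj)
    (powCol q j a)
  rw [← t_eq, ← h.Γ₁_eq hj.le] at key
  cases j with
  -- The leading Hankel matrix is 0 × 0, so its contribution is an empty sum.
  | zero =>
    rw [mParam, key, add_eq_right]
    ext
    simp [Matrix.mul_apply]
  | succ j =>
    rw [initEmb_conjTranspose_mul_powCol, ← t_eq] at key
    rw [mParam, key, add_sub_cancel_left]

lemma lParam_eq (h : IsRegular a b s n) (hj : j < n) :
    lParam a b s j =
      (Q₂ a b s j a)ᴴ * (hankelSchur (sHat a b s) j)⁻¹ * Q₂ a b s j a := by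
  have h0 := h.isHermitian 0 (by omega)
  have key := conjTranspose_mul_rectHankel_succ_inv_mul (k := j)
    (fun i hi => h.isHermitian_sHat (by omega)) (h.isUnit_sHat hj.le) (h.isUnit_sHat hj)
    (blockCol (upperMoment b s) 0 (j + 1))
  rw [← w_eq h0, ← h.Q₂_eq hj] at key
  cases j with
  | zero =>
    rw [lParam, key, add_eq_right]
    ext
    simp [Matrix.mul_apply]
  | succ j =>
    have hE : (initEmb q (j + 1))ᴴ * blockCol (upperMoment b s) 0 (j + 1 + 1) =
        blockCol (upperMoment b s) 0 (j + 1) := by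
      rw [initEmb_conjTranspose_mul]
      rfl
    rw [hE, ← w_eq h0] at key
    rw [lParam, key, add_sub_cancel_left]

lemma isUnit_hankelSchur_upperMoment (h : IsRegular a b s n) (hj : j < n) :
    IsUnit (hankelSchur (upperMoment b s) j) :=
  isUnit_hankelSchur (h.isUnit_upperMoment hj.le)
    (h.isUnit_upperMoment hj)

lemma isUnit_hankelSchur_sHat (h : IsRegular a b s n) (hj : j < n) :
    IsUnit (hankelSchur (sHat a b s) j) :=
  isUnit_hankelSchur (h.isUnit_sHat hj.le) (h.isUnit_sHat hj)

lemma isUnit_Q₂ (h : IsRegular a b s n) (hj : j < n) : IsUnit (Q₂ a b s j a) := by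
  have := h.isUnit_hankelSchur_upperMoment hj
  rw [← h.Q₂_mul_Γ₁ hj, IsUnit.mul_iff] at this
  exact this.1

lemma isUnit_Γ₁ (h : IsRegular a b s n) (hj : j < n) : IsUnit (Γ₁ b s j a) := by
  have := h.isUnit_hankelSchur_upperMoment hj
  rw [← h.Q₂_mul_Γ₁ hj, IsUnit.mul_iff] at this
  exact isUnit_star.1 this.2

lemma isUnit_mParam (h : IsRegular a b s n) (hj : j < n) : IsUnit (mParam a b s j) := by
  rw [h.mParam_eq hj]
  exact ((isUnit_star.2 (h.isUnit_Γ₁ hj)).mul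
    (Matrix.isUnit_nonsing_inv_iff.2 (h.isUnit_hankelSchur_upperMoment hj))).mul (h.isUnit_Γ₁ hj)

lemma isUnit_lParam (h : IsRegular a b s n) (hj : j < n) : IsUnit (lParam a b s j) := by
  rw [h.lParam_eq hj]
  exact ((isUnit_star.2 (h.isUnit_Q₂ hj)).mul
    (Matrix.isUnit_nonsing_inv_iff.2 (h.isUnit_hankelSchur_sHat hj))).mul (h.isUnit_Q₂ hj)

/-- In Q_j m_j = (Q_j Γ_j^*) S_j⁻¹ Γ_j the bracket is S_j. -/
lemma Q₂_eq_Γ₁_mul (h : IsRegular a b s n) (hj : j < n) :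
    Q₂ a b s j a = Γ₁ b s j a * (mParam a b s j)⁻¹ := by
  have hm := (Matrix.isUnit_iff_isUnit_det _).1 (h.isUnit_mParam hj)
  have hS := (Matrix.isUnit_iff_isUnit_det _).1 (h.isUnit_hankelSchur_upperMoment hj)
  have key : Q₂ a b s j a * mParam a b s j = Γ₁ b s j a := by
    rw [h.mParam_eq hj, ← Matrix.mul_assoc, ← Matrix.mul_assoc, h.Q₂_mul_Γ₁ hj,
      Matrix.mul_nonsing_inv _ hS, Matrix.one_mul]
  rw [← key, Matrix.mul_nonsing_inv_cancel_right _ _ hm]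

lemma Γ₁_succ_eq_Q₂_mul (h : IsRegular a b s n) (hj : j < n) :
    Γ₁ b s (j + 1) a = -(Q₂ a b s j a * (lParam a b s j)⁻¹) := by
  have hl := (Matrix.isUnit_iff_isUnit_det _).1 (h.isUnit_lParam hj)
  have hS := (Matrix.isUnit_iff_isUnit_det _).1 (h.isUnit_hankelSchur_sHat hj)
  have key : Γ₁ b s (j + 1) a * lParam a b s j = -Q₂ a b s j a := by
    rw [h.lParam_eq hj, ← Matrix.mul_assoc, ← Matrix.mul_assoc, h.Γ₁_succ_mul_Q₂ hj,
      Matrix.neg_mul, Matrix.mul_nonsing_inv _ hS, Matrix.neg_mul, Matrix.one_mul]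
  rw [← Matrix.neg_mul, ← key, Matrix.mul_nonsing_inv_cancel_right _ _ hl]

lemma Γ₁_eq_invProd (h : IsRegular a b s n) (hj : j ≤ n) :
    Γ₁ b s j a = (-1) ^ j * invProd a b s j := by
  induction j with
  | zero =>
    -- In degree 0 the monic polynomial is the constant I.
    have hE : powCol q 0 (a : ℂ) = lastCol q 0 := by
      apply R_mul_eq
      ext ⟨i, α⟩ β
      rw [Matrix.sub_mul, Matrix.one_mul, Matrix.smul_mul, Matrix.sub_apply, Matrix.smul_apply,
        Fin.fin_one_eq_zero i, T_mul_zero]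
      simp [v, colCons, lastCol, Matrix.one_apply]
    rw [h.Γ₁_eq hj, hE, orthRow_mul_lastCol, invProd, pow_zero, one_mul]
  | succ j ih =>
    rw [h.Γ₁_succ_eq_Q₂_mul hj, h.Q₂_eq_Γ₁_mul hj, ih (by omega), invProd, pow_succ]
    simp only [mul_assoc, neg_mul, mul_neg, one_mul]

end IsRegular

/-! ### Regularity from positive definiteness. -/

lemma isHermitian_of_H₁ {s : ℕ → Mat q} {n : ℕ} (h : (H₁ s n).IsHermitian) {k : ℕ}
    (hk : k ≤ 2 * n) : (s k).IsHermitian := by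
  ext α β
  -- Both indices must be at most n; halving k ensures this.
  have := h.apply (⟨k / 2, by omega⟩, α) (⟨k - k / 2, by omega⟩, β)
  simpa [H₁, blockHankel, show k - k / 2 + k / 2 = k by omega,
    show k / 2 + (k - k / 2) = k by omega] using this

lemma posDef_rectHankel_of_le {f : ℕ → Mat q} {m k : ℕ} (h : (rectHankel f m m).PosDef)
    (hk : k ≤ m) : (rectHankel f k k).PosDef := by
  have := h.submatrix (e := fun x : Fin k × Fin q => (Fin.castLE hk x.1, x.2)) fun x y hxy => by
    simpa [Prod.ext_iff, Fin.ext_iff] using hxy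
  exact this

/-- The conjugating matrix is multiplication by c + d x, so the moments acquire the weight (c + d
x)². -/
lemma conjTranspose_mul_rectHankel_mul (c d : ℝ) (f : ℕ → Mat q) (k : ℕ) :
    ((c : ℂ) • initEmb q k + (d : ℂ) • tailEmb q k)ᴴ * rectHankel f (k + 1) (k + 1) *
        ((c : ℂ) • initEmb q k + (d : ℂ) • tailEmb q k) =
      rectHankel (fun i => (c ^ 2 : ℂ) • f i + (2 * c * d : ℂ) • f (i + 1) +
        (d ^ 2 : ℂ) • f (i + 2)) k k := by
  simp only [Matrix.conjTranspose_add, Matrix.conjTranspose_smul, Complex.star_def,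
    Complex.conj_ofReal, Matrix.add_mul, Matrix.mul_add, Matrix.smul_mul, Matrix.mul_smul,
    initEmb_conjTranspose_mul, tailEmb_conjTranspose_mul, mul_initEmb, mul_tailEmb]
  ext ⟨i, α⟩ ⟨l, β⟩
  simp [rectHankel, add_right_comm _ 1, ← add_assoc]
  ring

lemma isRegular_of_posDef {a b : ℝ} (hab : a < b) {s : ℕ → Mat q} {n : ℕ}
    (hH₁ : (rectHankel s (n + 1) (n + 1)).PosDef) (hH₂ : (rectHankel (sHat a b s) n n).PosDef) :
    IsRegular a b s n := by
  have hK₁ : (rectHankel (upperMoment b s) n n).PosDef := by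
    -- Uses (b - x)(x - a) + (b - x)² = (b - a)(b - x).
    have h := (hH₂.add_posSemidef (hH₁.posSemidef.conjTranspose_mul_mul_same
      ((b : ℂ) • initEmb q n + ((-1 : ℝ) : ℂ) • tailEmb q n))).smul
      (inv_pos.2 (Complex.zero_lt_real.2 (sub_pos.2 hab)))
    have hne : ((b - a : ℝ) : ℂ) ≠ 0 := Complex.ofReal_ne_zero.2 (sub_pos.2 hab).ne'
    convert h
    rw [conjTranspose_mul_rectHankel_mul, eq_inv_smul_iff₀ hne]
    ext x y
    simp [rectHankel, sHat, upperMoment, ← add_assoc]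
    ring
  refine ⟨fun k hk => isHermitian_of_H₁ hH₁.isHermitian hk, fun j hj => ?_, fun j hj => ?_⟩
  · rw [K₁_eq]
    exact (posDef_rectHankel_of_le hK₁ hj).isUnit
  · rw [H₂_eq]
    exact (posDef_rectHankel_of_le hH₂ hj).isUnit

lemma posDef_H₁_of_posDef_K {a b : ℝ} (hab : a < b) {s : ℕ → Mat q} {n : ℕ}
    (hK₁ : (K₁ b s n).PosDef) (hK₂ : (K₂ a s n).PosDef) :
    (rectHankel s (n + 1) (n + 1)).PosDef := by
  have h := (hK₁.add hK₂).smul (inv_pos.2 (Complex.zero_lt_real.2 (sub_pos.2 hab)))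
  have hne : ((b - a : ℝ) : ℂ) ≠ 0 := Complex.ofReal_ne_zero.2 (sub_pos.2 hab).ne'
  convert h
  rw [eq_inv_smul_iff₀ hne]
  ext x y
  simp [rectHankel, K₁, K₂, blockHankel]
  ring

/-- Rests on (x - a)²(b - x) + (b - x)²(x - a) = (b - a)(b - x)(x - a), with `A` and `B`
multiplication by x - a and b - x. -/
lemma posDef_sHat_of_posDef_K {a b : ℝ} (hab : a < b) {s : ℕ → Mat q} {n : ℕ}
    (hK₁ : (K₁ b s n).PosDef) (hK₂ : (K₂ a s n).PosDef) :
    (rectHankel (sHat a b s) n n).PosDef := by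
  have hne : ((b - a : ℝ) : ℂ) ≠ 0 := Complex.ofReal_ne_zero.2 (sub_pos.2 hab).ne'
  set B := (b : ℂ) • initEmb q n + ((-1 : ℝ) : ℂ) • tailEmb q n with hB
  set A := ((-a : ℝ) : ℂ) • initEmb q n + ((1 : ℝ) : ℂ) • tailEmb q n with hA
  have hAB : A + B = ((b - a : ℝ) : ℂ) • initEmb q n := by
    rw [hA, hB]
    push_cast
    module
  have h₁ := hK₁.posSemidef.conjTranspose_mul_mul_same A
  have h₂ := hK₂.posSemidef.conjTranspose_mul_mul_same B
  have h : (Aᴴ * K₁ b s n * A + Bᴴ * K₂ a s n * B).PosDef := by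
    refine Matrix.PosDef.of_dotProduct_mulVec_pos (h₁.add h₂).isHermitian fun x hx => ?_
    have hquad : ∀ (M : BlockMat (n + 1) q) (C : Matrix (Fin (n + 1) × Fin q) (Fin n × Fin q) ℂ),
        star x ⬝ᵥ ((Cᴴ * M * C) *ᵥ x) = star (C *ᵥ x) ⬝ᵥ (M *ᵥ (C *ᵥ x)) := fun M C => by
      rw [Matrix.star_mulVec, Matrix.dotProduct_mulVec, Matrix.dotProduct_mulVec,
        Matrix.dotProduct_mulVec, Matrix.vecMul_vecMul, Matrix.vecMul_vecMul,
        Matrix.mul_assoc]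
    rw [Matrix.add_mulVec, dotProduct_add]
    -- `A` and `B` cannot both kill x: their sum is b - a times an injective embedding. A nonzero
    -- image makes its summand strictly positive.
    by_cases hAx : A *ᵥ x = 0
    · refine add_pos_of_nonneg_of_pos (h₁.dotProduct_mulVec_nonneg x) ?_
      rw [hquad]
      refine hK₂.dotProduct_mulVec_pos fun hBx => hx ?_
      have h0 : initEmb q n *ᵥ x = 0 := by
        have : (A + B) *ᵥ x = 0 := by rw [Matrix.add_mulVec, hAx, hBx, add_zero]
        rw [hAB, Matrix.smul_mulVec] at this
        exact (smul_eq_zero.1 this).resolve_left hne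
      rw [← Matrix.one_mulVec x, ← initEmb_conjTranspose_mul_initEmb, ← Matrix.mulVec_mulVec, h0,
        Matrix.mulVec_zero]
    · refine add_pos_of_pos_of_nonneg ?_ (h₂.dotProduct_mulVec_nonneg x)
      rw [hquad]
      exact hK₁.dotProduct_mulVec_pos hAx
  convert h.smul (inv_pos.2 (Complex.zero_lt_real.2 (sub_pos.2 hab)))
  have hK₂' : K₂ a s n = rectHankel (fun k => s (k + 1) - (a : ℂ) • s k) (n + 1) (n + 1) := by
    ext x y
    simp [K₂, blockHankel, rectHankel, sub_eq_neg_add]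
  rw [eq_inv_smul_iff₀ hne, hA, hB, K₁_eq, hK₂', conjTranspose_mul_rectHankel_mul,
    conjTranspose_mul_rectHankel_mul]
  ext x y
  simp [rectHankel, sHat, upperMoment, add_assoc]
  ring

lemma IsHausdorffPosDef.isRegular {a b : ℝ} (hab : a < b) {s : ℕ → Mat q} {n : ℕ}
    (h : IsHausdorffPosDef a b s (2 * n) ∨ IsHausdorffPosDef a b s (2 * n + 1)) :
    IsRegular a b s n := by
  rcases h with h | h
  · refine isRegular_of_posDef hab (h.1 n rfl) ?_
    cases n with
    | zero =>
      refine Matrix.PosDef.of_dotProduct_mulVec_pos ?_ fun x hx => absurd (Subsingleton.elim x 0) hx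
      ext x
      exact x.1.elim0
    | succ j => exact H₂_eq a b s j ▸ h.2.1 j rfl
  · obtain ⟨hK₁, hK₂⟩ := h.2.2 n rfl
    exact isRegular_of_posDef hab (posDef_H₁_of_posDef_K hab hK₁ hK₂)
      (posDef_sHat_of_posDef_K hab hK₁ hK₂)

end HausdorffMoment

end

theorem proposition7p1 {q n : ℕ} (a b : ℝ) (hab : a < b)
    (s : ℕ → HausdorffMoment.Mat q)
    (hs : HausdorffMoment.IsHausdorffPosDef a b s (2 * n) ∨
      HausdorffMoment.IsHausdorffPosDef a b s (2 * n + 1)) :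
    (∀ j, j < n → IsUnit (HausdorffMoment.mParam a b s j) ∧
      IsUnit (HausdorffMoment.lParam a b s j)) ∧
    (∀ j, j < n →
      HausdorffMoment.Q₂ a b s j a =
        (-1) ^ j * (HausdorffMoment.invProd a b s j * (HausdorffMoment.mParam a b s j)⁻¹)) ∧
    (∀ j, 1 ≤ j → j ≤ n →
      HausdorffMoment.Γ₁ b s j a = (-1) ^ j * HausdorffMoment.invProd a b s j) ∧
    (∀ j, 1 ≤ j → j < n →
      HausdorffMoment.P₂ a b s j a =
        (-1) ^ j * (HausdorffMoment.invProd a b s j * (HausdorffMoment.mParam a b s j)⁻¹ *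
          ∑ k ∈ Finset.range (j + 1), HausdorffMoment.mParam a b s k)) ∧
    (∀ j, 1 ≤ j → j ≤ n →
      HausdorffMoment.Θ₁ b s j a =
        (-1) ^ j * (HausdorffMoment.invProd a b s j *
          (s 0 + ∑ k ∈ Finset.range j, HausdorffMoment.lParam a b s k))) := by
  have h := HausdorffMoment.IsHausdorffPosDef.isRegular hab hs
  refine ⟨fun j hj => ⟨h.isUnit_mParam hj, h.isUnit_lParam hj⟩, fun j hj => ?_,
    fun j _ hj => h.Γ₁_eq_invProd hj, fun j _ hj => ?_, fun j hj1 hj => ?_⟩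
  · rw [h.Q₂_eq_Γ₁_mul hj, h.Γ₁_eq_invProd hj.le, mul_assoc]
  · rw [h.P₂_eq_Q₂_mul hj, h.Q₂_eq_Γ₁_mul hj, h.Γ₁_eq_invProd hj.le,
      HausdorffMoment.sum_mParam]
    simp only [mul_assoc]
  · obtain ⟨j, rfl⟩ := Nat.exists_eq_add_of_le' hj1
    rw [h.Θ₁_succ_eq_Γ₁_mul hj, h.Γ₁_eq_invProd hj, HausdorffMoment.sum_lParam, mul_assoc]
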